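/- For a finite simple graph $\Gamma$, the right-angled Artin group (RAAG) of $\Gamma$ is the group $\langle V(\Gamma)\mid [u,v]=1 \text{ whenever } u,v \text{ are adjacent in }\Gamma\rangle$. A finite subset $S$ of a group $H$ is called a \emph{RAAG generating set} of $H$ if there is a simple graph with vertex set $S$ such that the inclusion $S\subseteq H$ induces an isomorphism from its RAAG onto $H$. A group is \emph{$\mathbb{Z}$-linear} if it embeds in $GL_n(\mathbb{Z})$ for some $n$. Let $m\ge 0$ and let $S_m$ be the star graph with a central vertex $v_0$, external vertices $v_1,\dots,v_m$, and for each $i=1,\dots,m$ one edge $e_i$ from $v_0$ to $v_i$. Let $(\mathcal{G},S_m)$ be a graph of groups over $S_m$ such that the group $G_{v_0}$ of the central vertex is free abelian of finite rank, each group $G_{v_i}$ of an external vertex is a right-angled Artin group with a given (standard) RAAG generating set $S_i$, and each edge group $G_{e_i}$ is cyclic, generated by an element $k_i$. Let $\alpha_{e_i}:G_{e_i}\to G_{v_0}$ and $\omega_{e_i}:G_{e_i}\to G_{v_i}$ be the monomorphisms of the edge groups. Assume that for every $i=1,\dots,m$ the element $\omega_{e_i}(k_i)$ either belongs to $S_i$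 or belongs to some (other) RAAG generating set of $G_{v_i}$. Then the fundamental group $\pi_1(\mathcal{G},S_m)$ of the graph of groups is $\mathbb{Z}$-linear. -/

import Mathlib

/-! ### Right-angled Artin groups -/

/-- The right-angled Artin group of a simple graph: one generator per vertex, adjacent
vertices commute. -/
abbrev RAAG {V : Type*} (Γ : SimpleGraph V) : Type _ :=
  PresentedGroup {r : FreeGroup V | ∃ u v, Γ.Adj u v ∧
    r = FreeGroup.of u * FreeGroup.of v * (FreeGroup.of u)⁻¹ * (FreeGroup.of v)⁻¹}

/-- `S` is a RAAG generating set of `G`: it is finite, and for some graph with vertex set `S`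
the group `G` is presented by the generators `S` subject to the commutation of adjacent
elements. -/
def IsRAAGGeneratingSet {G : Type*} [Group G] (S : Set G) : Prop :=
  S.Finite ∧ ∃ (Γ : SimpleGraph S) (φ : RAAG Γ ≃* G), ∀ s : S, φ (PresentedGroup.of s) = (s : G)

/-! ### Free abelian groups of finite rank, and linearity over the integers -/

/-- `G` is a free abelian group of finite rank (written multiplicatively). -/
def IsFreeAbelianOfFiniteRank (G : Type*) [Group G] : Prop :=
  ∃ n : ℕ, Nonempty (G ≃* Multiplicative (Fin n → ℤ))

/-- `G` is `ℤ`-linear: it has a faithful representation in some `GL_n(ℤ)`. -/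
def IsZLinear (G : Type*) [Group G] : Prop :=
  ∃ (n : ℕ) (ρ : G →* Matrix.GeneralLinearGroup (Fin n) ℤ), Function.Injective ρ

/-! ### Graphs, graphs of groups, fundamental groups -/

/-- A graph (loops and multiple edges allowed) with vertex set `V`. The elements of `E` are the
pairs `{e, ē}` of mutually inverse edges, each with a chosen orientation `e`; `src e` is the initial
and `tgt e` the terminal vertex of `e`. -/
structure OrientedGraph (V E : Type*) where
  src : E → V
  tgt : E → V

/-- The set `T` of edges is (the edge set of) a maximal subtree: it has no loops and no parallel
edges, and the simple graph on all the vertices which it defines is a tree. -/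
def OrientedGraph.IsMaximalSubtree {V E : Type*} (Γ : OrientedGraph V E) (T : Set E) : Prop :=
  (∀ e ∈ T, Γ.src e ≠ Γ.tgt e) ∧
  Set.InjOn (fun e => s(Γ.src e, Γ.tgt e)) T ∧
  (SimpleGraph.fromEdgeSet ((fun e => s(Γ.src e, Γ.tgt e)) '' T)).IsTree

/-- A graph of groups over `Γ`: vertex groups, edge groups, and monomorphisms `α e`, `ω e`
of each edge group into the groups of the initial and of the terminal vertex of `e`. -/
structure GraphOfGroups.{u, v, w} {V : Type v} {E : Type w} (Γ : OrientedGraph V E) where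
  vertexGroup : V → Type u
  edgeGroup : E → Type u
  [vertexGroupInst : ∀ v, Group (vertexGroup v)]
  [edgeGroupInst : ∀ e, Group (edgeGroup e)]
  α : ∀ e, edgeGroup e →* vertexGroup (Γ.src e)
  ω : ∀ e, edgeGroup e →* vertexGroup (Γ.tgt e)
  α_injective : ∀ e, Function.Injective (α e)
  ω_injective : ∀ e, Function.Injective (ω e)

attribute [instance] GraphOfGroups.vertexGroupInst GraphOfGroups.edgeGroupInst

namespace GraphOfGroups

variable {V E : Type*} {Γ : OrientedGraph V E} (𝒢 : GraphOfGroups Γ)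

/-- The free product of all vertex groups and of the free group on the letters `t_e`. -/
abbrev BigFreeProduct : Type _ := Monoid.Coprod (Monoid.CoprodI 𝒢.vertexGroup) (FreeGroup E)

/-- The inclusion of a vertex group in the big free product. -/
def ofVertex (v : V) : 𝒢.vertexGroup v →* 𝒢.BigFreeProduct :=
  Monoid.Coprod.inl.comp Monoid.CoprodI.of

/-- The letter `t_e` in the big free product. -/
def letter (e : E) : 𝒢.BigFreeProduct := Monoid.Coprod.inr (FreeGroup.of e)

/-- The relators `t_e α_e(g) t_e⁻¹ ω_e(g)⁻¹`. The letter of the inverse edge `ē` is `t_e⁻¹`,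
so that the relators of `ē` are consequences of these. -/
def pathRelators : Set 𝒢.BigFreeProduct :=
  {x | ∃ (e : E) (g : 𝒢.edgeGroup e),
    x = 𝒢.letter e * 𝒢.ofVertex _ (𝒢.α e g) * (𝒢.letter e)⁻¹ * (𝒢.ofVertex _ (𝒢.ω e g))⁻¹}

/-- The path group of a graph of groups. -/
abbrev PathGroup : Type _ := 𝒢.BigFreeProduct ⧸ Subgroup.normalClosure 𝒢.pathRelators

/-- The element `t_e` of the path group. -/
def stableLetter (e : E) : 𝒢.PathGroup := QuotientGroup.mk (𝒢.letter e)

/-- The fundamental group of a graph of groups with respect to a maximal subtree `T`: the quotient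
of the path group by the normal closure of the `t_e` with `e` in `T`. -/
abbrev FundamentalGroup (T : Set E) : Type _ :=
  𝒢.PathGroup ⧸ Subgroup.normalClosure (𝒢.stableLetter '' T)

end GraphOfGroups

/-- The star graph `S_m`: a central vertex `none`, external vertices `some i` for `i < m`, and for
each `i` one edge from the central vertex to `some i`. -/
def starGraph (m : ℕ) : OrientedGraph (Option (Fin m)) (Fin m) where
  src _ := none
  tgt i := some i

/-- The star graph is a tree: its set of all edges is a maximal subtree. -/
theorem starGraph_isMaximalSubtree_univ (m : ℕ) :
    (starGraph m).IsMaximalSubtree Set.univ := by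
  refine ⟨fun e _ => by simp [starGraph], fun a _ b _ h => by simpa [starGraph] using h, ?_⟩
  convert SimpleGraph.isTree_starGraph (none : Option (Fin m)) using 1
  ext x y
  rw [SimpleGraph.starGraph_adj, SimpleGraph.fromEdgeSet_adj]
  rcases x with _ | x <;> rcases y with _ | y <;> simp [starGraph]

/-! Every edge of a star lies in its maximal subtree, so the fundamental group is `ℤⁿ` amalgamated
with the Artin groups along `a l = t l`, where `t l` belongs to a RAAG generating set. Eliminating
each `t l` leaves a group generated by `ℤⁿ` and finitely many vertices `v`; its relations say that
adjacent vertices commute and that `v` commutes with a vector `b v` (`isZLinear_of_amalgam`,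
`isZLinear_of_graph`).

Such a group is `K · ℤⁿ`, where `K` is generated by the translates of the vertices `v`, indexed by
`ℤⁿ / ⟨b v⟩`. These are infinitely many, but they act on a lattice of finite rank: each translate
has a width, each vertex a single position shared by its translates, and playing a translate changes
the widths linearly, through a coefficient `c v w` that vanishes exactly at translates that coincide
or commute. The multiples of a vector are the zeros of a quadratic function with periodic
coefficients (`exists_quasiQuadratic_zero_iff`), so `c` can be chosen among these functions
(`exists_interaction`), and the widths stay in a finitely generated, translation-invariant module.

Faithfulness on `K` is a ping-pong argument (`IsNumbersGame.state_of_minimal`): a nonempty shortest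
word pushes some position beyond its width. The lattice is detected by its translations of the
coordinate functions (`isZLinear_of_interaction`). -/

/-! ### A numbers game for groups with partially commuting generators -/

/-- A numbers game: each generator `x y` has a width `s y` and a position `u y`, depending on the
group element reached so far. Playing `x y ^ k` moves the position of `y` by `4 k` widths; it leaves
alone the generators that are not far from `y` and widens those that are far from `y`. -/
structure IsNumbersGame {G Ω : Type*} [Group G] (x : Ω → G) (s u : Ω → G → ℤ)
    (far : Ω → Ω → Prop) : Prop where
  s_one : ∀ y, 0 < s y 1
  u_one : ∀ y, u y 1 = 0
  s_self : ∀ y (k : ℤ) g, s y (x y ^ k * g) = s y g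
  u_self : ∀ y (k : ℤ) g, u y (x y ^ k * g) = u y g + 4 * k * s y g
  far_irrefl : ∀ y, ¬ far y y
  far_symm : ∀ y z, far y z → far z y
  comm : ∀ y z, y ≠ z → ¬ far y z → Commute (x y) (x z)
  s_comm : ∀ y z, y ≠ z → ¬ far y z → ∀ (k : ℤ) g, s z (x y ^ k * g) = s z g
  u_comm : ∀ y z, y ≠ z → ¬ far y z → ∀ (k : ℤ) g, u z (x y ^ k * g) = u z g
  s_far : ∀ y z, far y z → ∃ c : ℤ, 8 ≤ c ∧ ∀ (k : ℤ) g,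
    s z (x y ^ k * g) = s z g + c * (k * u y g + 2 * k ^ 2 * s y g)
  u_far : ∀ y z, far y z → ∀ (k : ℤ) g,
    u z (x y ^ k * g) = u z g ∨ u z (x y ^ k * g) = u z g + 4 * k * s y g

/-- The product of the syllables `x y ^ k` of a word. -/
def syllableProd {G Ω : Type*} [Group G] (x : Ω → G) (l : List (Ω × ℤ)) : G :=
  (l.map fun p => x p.1 ^ p.2).prod

namespace IsNumbersGame

variable {G Ω : Type*} [Group G] {x : Ω → G} {s u : Ω → G → ℤ} {far : Ω → Ω → Prop}

theorem abs_mul_le_mul_add_sq {σ v k : ℤ} (hk : k ≠ 0) (h : |v| < σ) :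
    |k| * σ ≤ k * v + 2 * k ^ 2 * σ := by
  have h1 : -(|k| * |v|) ≤ k * v := by rw [← abs_mul]; exact neg_abs_le _
  have h2 : 1 ≤ |k| := Int.one_le_abs hk
  have h3 : k ^ 2 = |k| ^ 2 := (sq_abs k).symm
  have h4 : 0 ≤ |v| := abs_nonneg v
  rw [h3]
  nlinarith [mul_le_mul_of_nonneg_left h.le (abs_nonneg k),
    mul_nonneg (mul_nonneg (abs_nonneg k) (sub_nonneg.2 h2)) (h4.trans h.le)]

/-- The state reached by a shortest word of syllables. -/
theorem state_of_minimal (H : IsNumbersGame x s u far) (n : ℕ) : ∀ g : G,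
    (∃ l, l.length = n ∧ syllableProd x l = g) →
    (∀ l, syllableProd x l = g → n ≤ l.length) →
    (∀ y, 0 < s y g) ∧
    (∀ y z, far y z → 0 < (s y g - |u y g|) + (s z g - |u z g|)) ∧
    (∀ y, |u y g| < s y g ∨ ∃ (k : ℤ) (l : List (Ω × ℤ)),
      l.length < n ∧ syllableProd x l = x y ^ k * g) ∧
    (n ≠ 0 → ∃ y, s y g < |u y g|) := by
  -- Invariants: of two generators far from each other at most one is outside its width, and a
  -- generator not strictly inside can be cancelled to shorten the word.
  induction n with
  | zero =>
    rintro g ⟨l, hl, rfl⟩ -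
    obtain rfl := List.length_eq_zero_iff.1 hl
    have h1 : syllableProd x [] = 1 := by simp [syllableProd]
    rw [h1]
    refine ⟨H.s_one, fun y z _ => ?_, fun y => Or.inl ?_, fun h => absurd rfl h⟩
    · have := H.s_one y
      have := H.s_one z
      simp [H.u_one]; omega
    · simpa [H.u_one] using H.s_one y
  | succ n ih =>
    rintro g ⟨l, hl, hg⟩ hmin
    obtain ⟨⟨y, k⟩, l, rfl⟩ := List.exists_cons_of_length_eq_add_one hl
    have hcons : ∀ (z : Ω) (j : ℤ) l, syllableProd x ((z, j) :: l) = x z ^ j * syllableProd x l := by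
      intro z j l; simp [syllableProd]
    have hl' : l.length = n := by simpa using hl
    obtain ⟨g', hg'⟩ : ∃ g', syllableProd x l = g' := ⟨_, rfl⟩
    rw [hcons, hg'] at hg
    subst hg
    obtain ⟨hs, hI, hd, -⟩ := ih g' ⟨l, hl', hg'⟩ (fun l' h' => by
      have := hmin ((y, k) :: l') (by rw [hcons, h'])
      simpa using this)
    have hk : k ≠ 0 := by
      rintro rfl
      have := hmin l (by simp [hg'])
      omega
    -- Otherwise the new syllable would merge with a cancellable syllable of `y`, against
    -- minimality.
    have hy : |u y g'| < s y g' := by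
      rcases hd y with h | ⟨j, l', h', he⟩
      · exact h
      · have := hmin ((y, k - j) :: l') (by rw [hcons, he, ← mul_assoc, ← zpow_add]; simp)
        simp at this; omega
    have hk1 : 1 ≤ |k| := Int.one_le_abs hk
    have hsy := hs y
    have hks : s y g' ≤ |k| * s y g' := le_mul_of_one_le_left hsy.le hk1
    have hest := abs_mul_le_mul_add_sq hk hy
    have habs : |4 * k * s y g'| = 4 * (|k| * s y g') := by
      rw [abs_mul, abs_mul, abs_of_pos hsy]; norm_num; ring
    -- The move has size at least four widths and starts inside, so it ends outside.
    have hself : s y g' - |u y g'| - 4 * (|k| * s y g') ≤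
        s y (x y ^ k * g') - |u y (x y ^ k * g')| ∧
        s y (x y ^ k * g') < |u y (x y ^ k * g')| := by
      rw [H.s_self, H.u_self, ← habs]
      have h1 := abs_add_le (u y g') (4 * k * s y g')
      have h2 := abs_sub_abs_le_abs_sub (4 * k * s y g') (-u y g')
      rw [abs_neg, sub_neg_eq_add, add_comm] at h2
      constructor <;> omega
    -- The width gains at least `8 |k| s y` and the position moves by at most `4 |k| s y`; the net
    -- gain pays for the loss allowed in `hself`.
    have hfar : ∀ z, far y z → s z g' ≤ s z (x y ^ k * g') ∧
        s z g' - |u z g'| + 4 * (|k| * s y g') ≤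
          s z (x y ^ k * g') - |u z (x y ^ k * g')| := by
      intro z hz
      obtain ⟨c, hc, hcs⟩ := H.s_far y z hz
      have h1 : 8 * (|k| * s y g') ≤ c * (k * u y g' + 2 * k ^ 2 * s y g') :=
        mul_le_mul hc hest (by positivity) (by omega)
      have h2 : |u z (x y ^ k * g')| ≤ |u z g'| + 4 * (|k| * s y g') := by
        rcases H.u_far y z hz k g' with h | h
        · rw [h]; omega
        · rw [h, ← habs]; exact abs_add_le _ _
      rw [hcs] at *
      constructor <;> omega
    have hother : ∀ z, z ≠ y → s z g' ≤ s z (x y ^ k * g') ∧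
        s z g' - |u z g'| ≤ s z (x y ^ k * g') - |u z (x y ^ k * g')| := by
      intro z hz
      by_cases hf : far y z
      · have := hfar z hf
        constructor <;> omega
      · rw [H.s_comm y z hz.symm hf, H.u_comm y z hz.symm hf]
        exact ⟨le_rfl, le_rfl⟩
    have hpair : ∀ z, far y z → 0 < (s y (x y ^ k * g') - |u y (x y ^ k * g')|) +
        (s z (x y ^ k * g') - |u z (x y ^ k * g')|) := by
      intro z hz
      have h1 := hI y z hz
      have h2 := (hfar z hz).2
      have h3 := hself.1
      omega
    refine ⟨fun z => ?_, fun z w hzw => ?_, fun z => ?_, fun _ => ⟨y, hself.2⟩⟩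
    · by_cases hz : z = y
      · subst hz; rwa [H.s_self]
      · exact (hs z).trans_le (hother z hz).1
    · by_cases hz : z = y
      · subst hz; exact hpair w hzw
      · by_cases hw : w = y
        · subst hw; have := hpair z (H.far_symm _ _ hzw); omega
        · have := hI z w hzw
          have := (hother z hz).2
          have := (hother w hw).2
          omega
    · by_cases hz : z = y
      · subst hz
        exact Or.inr ⟨-k, l, by omega, by rw [hg']; simp⟩
      -- A far `z` is pulled back inside its width. Any other `z` commutes with `y`, so a shortening
      -- by `z` survives the new syllable.
      · by_cases hf : far y z
        · left
          have h1 := (hfar z hf).2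
          have h2 := hI y z hf
          have h3 := abs_nonneg (u y g')
          omega
        · rcases hd z with h | ⟨j, l', h', he⟩
          · left; rwa [H.s_comm y z (Ne.symm hz) hf, H.u_comm y z (Ne.symm hz) hf]
          · refine Or.inr ⟨j, (y, k) :: l', by simpa using h', ?_⟩
            rw [hcons, he, ← mul_assoc, ← mul_assoc]
            congr 1
            exact ((H.comm y z (Ne.symm hz) hf).zpow_zpow k j).eq

/-- An element which leaves all positions within the widths is trivial. -/
theorem eq_one_of_abs_lt (H : IsNumbersGame x s u far) {g : G}
    (hg : g ∈ Subgroup.closure (Set.range x)) (h : ∀ y, |u y g| ≤ s y g) : g = 1 := by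
  have hex : ∃ n, ∃ l, l.length = n ∧ syllableProd x l = g := by
    clear h
    induction hg using Subgroup.closure_induction with
    | mem z hz =>
      obtain ⟨y, rfl⟩ := hz
      exact ⟨_, [(y, 1)], rfl, by simp [syllableProd]⟩
    | one => exact ⟨_, [], rfl, by simp [syllableProd]⟩
    | mul a b _ _ ha hb =>
      obtain ⟨_, la, -, rfl⟩ := ha
      obtain ⟨_, lb, -, rfl⟩ := hb
      exact ⟨_, la ++ lb, rfl, by simp [syllableProd]⟩
    | inv a _ ha =>
      obtain ⟨_, la, -, rfl⟩ := ha
      refine ⟨_, (la.map fun p => (p.1, -p.2)).reverse, rfl, ?_⟩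
      simp [syllableProd, List.prod_inv_reverse, Function.comp_def]
  classical
  obtain ⟨l, hl, hlg⟩ := Nat.find_spec hex
  have h4 := (H.state_of_minimal (Nat.find hex) g (Nat.find_spec hex)
    (fun l' h' => Nat.find_min' hex ⟨l', rfl, h'⟩)).2.2.2
  by_cases h0 : Nat.find hex = 0
  · rw [h0] at hl
    obtain rfl := List.length_eq_zero_iff.1 hl
    simpa [syllableProd] using hlg.symm
  · obtain ⟨y, hy⟩ := h4 h0
    exact absurd (h y) (not_le.2 hy)

end IsNumbersGame

/-! ### Quasi-quadratic functions on a lattice -/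

/-- The integral affine functions on `ℤⁿ`. -/
def affineFunctions (n : ℕ) : Submodule ℤ ((Fin n → ℤ) → ℤ) :=
  Submodule.span ℤ (Set.range fun (o : Option (Fin n)) (a : Fin n → ℤ) => o.elim 1 a)

/-- The integral functions on `ℤⁿ` which are periodic modulo `N`. -/
def periodicFunctions (n N : ℕ) : Submodule ℤ ((Fin n → ℤ) → ℤ) :=
  LinearMap.range (LinearMap.funLeft ℤ ℤ fun (a : Fin n → ℤ) (j : Fin n) => (a j : ZMod N))

/-- The integral functions on `ℤⁿ` which are quadratic with coefficients periodic modulo `N`. -/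
def quasiQuadratic (n N : ℕ) : Submodule ℤ ((Fin n → ℤ) → ℤ) :=
  periodicFunctions n N * (affineFunctions n * affineFunctions n)

section quasiQuadratic

variable {n N : ℕ}

theorem quasiQuadratic_fg [NeZero N] : (quasiQuadratic n N).FG := by
  have h1 : (affineFunctions n).FG := Submodule.fg_span (Set.finite_range _)
  have h2 : (periodicFunctions n N).FG := by
    rw [periodicFunctions, LinearMap.range_eq_map]
    exact Module.Finite.fg_top.map _
  exact h2.mul (h1.mul h1)

theorem one_mem_affineFunctions : (1 : (Fin n → ℤ) → ℤ) ∈ affineFunctions n :=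
  Submodule.subset_span ⟨none, rfl⟩

theorem coord_mem_affineFunctions (j : Fin n) :
    (fun a : Fin n → ℤ => a j) ∈ affineFunctions n :=
  Submodule.subset_span ⟨some j, rfl⟩

theorem periodic_mem_periodicFunctions (f : (Fin n → ZMod N) → ℤ) :
    (fun a : Fin n → ℤ => f fun j => (a j : ZMod N)) ∈ periodicFunctions n N := ⟨f, rfl⟩

theorem one_mem_periodicFunctions : (1 : (Fin n → ℤ) → ℤ) ∈ periodicFunctions n N :=
  periodic_mem_periodicFunctions fun _ => 1

theorem mul_mem_quasiQuadratic {f g : (Fin n → ℤ) → ℤ} (hf : f ∈ affineFunctions n)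
    (hg : g ∈ affineFunctions n) : (fun a => f a * g a) ∈ quasiQuadratic n N := by
  have := Submodule.mul_mem_mul (one_mem_periodicFunctions (N := N)) (Submodule.mul_mem_mul hf hg)
  rwa [one_mul] at this

theorem affine_mem_quasiQuadratic {f : (Fin n → ℤ) → ℤ} (hf : f ∈ affineFunctions n) :
    f ∈ quasiQuadratic n N := by
  simpa using mul_mem_quasiQuadratic (N := N) hf one_mem_affineFunctions

theorem periodic_mem_quasiQuadratic (f : (Fin n → ZMod N) → ℤ) :
    (fun a : Fin n → ℤ => f fun j => (a j : ZMod N)) ∈ quasiQuadratic n N := by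
  have := Submodule.mul_mem_mul (periodic_mem_periodicFunctions f)
    (Submodule.mul_mem_mul (one_mem_affineFunctions (n := n)) one_mem_affineFunctions)
  simpa [quasiQuadratic] using this

theorem const_mem_quasiQuadratic (c : ℤ) : (fun _ => c) ∈ quasiQuadratic n N :=
  periodic_mem_quasiQuadratic fun _ => c

theorem translate_mem_mul {A : Type*} [AddGroup A] {M M' : Submodule ℤ (A → ℤ)}
    (h : ∀ f ∈ M, ∀ t, (fun a => f (a + t)) ∈ M) (h' : ∀ f ∈ M', ∀ t, (fun a => f (a + t)) ∈ M') :
    ∀ f ∈ M * M', ∀ t, (fun a => f (a + t)) ∈ M * M' := by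
  intro f hf t
  induction hf using Submodule.mul_induction_on' with
  | mem_mul_mem f hf g hg => exact Submodule.mul_mem_mul (h f hf t) (h' g hg t)
  | add f _ g _ hf hg => exact add_mem hf hg

/-- Translation preserves affine functions and periodic functions separately, hence their products.
This makes the lattice act on the finite-rank module. -/
theorem translate_mem_quasiQuadratic : ∀ f ∈ quasiQuadratic n N, ∀ t,
    (fun a => f (a + t)) ∈ quasiQuadratic n N := by
  have h1 : ∀ f ∈ affineFunctions n, ∀ t, (fun a => f (a + t)) ∈ affineFunctions n := by
    intro f hf t
    induction hf using Submodule.span_induction with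
    | mem f hf =>
      obtain ⟨o, rfl⟩ := hf
      cases o with
      | none => exact one_mem_affineFunctions
      | some j =>
        exact add_mem (coord_mem_affineFunctions j)
          (Submodule.smul_mem _ (t j) one_mem_affineFunctions |> fun h => by
            convert h using 1; ext; simp)
    | zero => exact zero_mem _
    | add f g _ _ hf hg => exact add_mem hf hg
    | smul c f _ hf => exact Submodule.smul_mem _ c hf
  refine translate_mem_mul ?_ (translate_mem_mul h1 h1)
  rintro _ ⟨f, rfl⟩ t
  refine ⟨fun b => f fun j => b j + (t j : ZMod N), ?_⟩
  ext a
  simp [LinearMap.funLeft]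

/-- For every `a` there is a quasi-quadratic function which is non-negative and even and vanishes
exactly on the multiples of `a`, modulo which it is periodic. -/
theorem exists_quasiQuadratic_zero_iff (a : Fin n → ℤ) : ∃ d : ℕ, d ≠ 0 ∧ ∀ N : ℕ, d ∣ N →
    ∃ D ∈ quasiQuadratic n N, (∀ x, 0 ≤ D x) ∧ (∀ x, D (-x) = D x) ∧
      (∀ x, D (x + a) = D x) ∧ ∀ x, D x = 0 ↔ x ∈ AddSubgroup.zmultiples a := by
  classical
  by_cases ha : a = 0
  · subst ha
    refine ⟨1, one_ne_zero, fun N _ => ⟨fun x => ∑ j, x j * x j, ?_, fun x => ?_, fun x => ?_,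
      fun x => ?_, fun x => ?_⟩⟩
    · have := Submodule.sum_mem (quasiQuadratic n N) (t := Finset.univ) fun j _ =>
        mul_mem_quasiQuadratic (coord_mem_affineFunctions j) (coord_mem_affineFunctions j)
      convert this using 1
      ext x; simp
    · exact Finset.sum_nonneg fun j _ => mul_self_nonneg _
    · simp
    · simp
    · rw [Finset.sum_eq_zero_iff_of_nonneg fun j _ => mul_self_nonneg _]
      simp [funext_iff]
  · obtain ⟨k, hk⟩ := Function.ne_iff.1 ha
    have hk : a k ≠ 0 := hk
    refine ⟨(a k).natAbs, Int.natAbs_ne_zero.2 hk, fun N hN => ?_⟩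
    let r : (Fin n → ℤ) →+ (Fin n → ZMod N) :=
      { toFun := fun x j => (x j : ZMod N), map_zero' := by ext; simp, map_add' := by
          intro x y; ext; simp }
    -- The minors `m i j` vanish together exactly on the rational line of `a`. On that line, a
    -- congruence modulo `N` to a multiple of `a` forces a true multiple, because `a k` divides `N`.
    let f : (Fin n → ZMod N) → ℤ := fun y => if y ∈ AddSubgroup.zmultiples (r a) then 0 else 1
    let m : Fin n → Fin n → (Fin n → ℤ) → ℤ := fun i j x => x i * a j - x j * a i
    have hm : ∀ i j, m i j ∈ affineFunctions n := by
      intro i j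
      have := sub_mem (Submodule.smul_mem _ (a j) (coord_mem_affineFunctions i))
        (Submodule.smul_mem _ (a i) (coord_mem_affineFunctions j))
      convert this using 1
      ext x; simp [m]; ring
    have hf0 : ∀ y, 0 ≤ f y := fun y => by simp only [f]; split_ifs <;> simp
    have hs0 : ∀ x, 0 ≤ ∑ i, ∑ j, m i j x * m i j x := fun x =>
      Finset.sum_nonneg fun i _ => Finset.sum_nonneg fun j _ => mul_self_nonneg _
    refine ⟨fun x => f (r x) + ∑ i, ∑ j, m i j x * m i j x, ?_, fun x => ?_, fun x => ?_,
      fun x => ?_, fun x => ?_⟩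
    · have := add_mem (periodic_mem_quasiQuadratic f) (Submodule.sum_mem (quasiQuadratic n N)
        (t := Finset.univ) fun i _ => Submodule.sum_mem (quasiQuadratic n N) (t := Finset.univ)
          fun j _ => mul_mem_quasiQuadratic (hm i j) (hm i j))
      convert this using 1
      ext x; simp [r]
    · exact add_nonneg (hf0 _) (hs0 _)
    · have h1 : f (r (-x)) = f (r x) := by simp only [f, map_neg, neg_mem_iff]
      have h2 : ∀ i j, m i j (-x) * m i j (-x) = m i j x * m i j x := fun i j => by
        simp only [m, Pi.neg_apply]; ring
      simp only [h1, h2]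
    · have h1 : f (r (x + a)) = f (r x) := by
        simp only [f, map_add, add_mem_cancel_right (AddSubgroup.mem_zmultiples (r a))]
      have h2 : ∀ i j, m i j (x + a) = m i j x := fun i j => by
        simp only [m, Pi.add_apply]; ring
      simp only [h1, h2]
    · constructor
      · intro h
        have h : f (r x) + ∑ i, ∑ j, m i j x * m i j x = 0 := h
        have h1 : f (r x) = 0 := by have := hf0 (r x); have := hs0 x; omega
        have h2 : ∑ i, ∑ j, m i j x * m i j x = 0 := by omega
        rw [Finset.sum_eq_zero_iff_of_nonneg fun i _ => Finset.sum_nonneg fun j _ =>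
          mul_self_nonneg _] at h2
        have h3 : ∀ i, x i * a k = x k * a i := fun i => by
          have := h2 i (Finset.mem_univ _)
          rw [Finset.sum_eq_zero_iff_of_nonneg fun j _ => mul_self_nonneg _] at this
          have := this k (Finset.mem_univ _)
          simpa [m, sub_eq_zero] using this
        have h4 : r x ∈ AddSubgroup.zmultiples (r a) := by
          by_contra h; simp [f, h] at h1
        obtain ⟨c, hc⟩ := AddSubgroup.mem_zmultiples_iff.1 h4
        have h5 : ∀ j, a k ∣ x j - c * a j := fun j => by
          have h6 : (N : ℤ) ∣ x j - c * a j := by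
            rw [← ZMod.intCast_eq_intCast_iff_dvd_sub]
            simpa [r] using congrFun hc j
          exact (Int.natAbs_dvd.1 (Int.natCast_dvd_natCast.2 hN)).trans h6
        obtain ⟨e, he⟩ := h5 k
        refine AddSubgroup.mem_zmultiples_iff.2 ⟨c + e, ?_⟩
        ext j
        apply mul_right_cancel₀ hk
        rw [h3 j]
        simp only [Pi.smul_apply, smul_eq_mul]
        linear_combination (-(a j)) * he
      · intro h
        obtain ⟨c, rfl⟩ := AddSubgroup.mem_zmultiples_iff.1 h
        have h1 : f (r (c • a)) = 0 := by
          simp only [f, map_zsmul]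
          rw [if_pos (zsmul_mem (AddSubgroup.mem_zmultiples _) c)]
        have h2 : ∀ i j, m i j (c • a) = 0 := fun i j => by
          simp only [m, Pi.smul_apply, smul_eq_mul]; ring
        simp only [h1, h2]
        simp

end quasiQuadratic

/-! ### A linear representation attached to commuting translates -/

universe u

/-- A finite type of generators `v`, each with a subgroup `B v` of `ℤⁿ`, and a function `c v w` on
`ℤⁿ` whose zeros tell which translates of `v` and `w` coincide or commute. -/
structure IsInteraction {V : Type*} {n : ℕ} (N : ℕ) (B : V → AddSubgroup (Fin n → ℤ))
    (c : V → V → (Fin n → ℤ) → ℤ) : Prop where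
  mem : ∀ v w, c v w ∈ quasiQuadratic n N
  symm : ∀ v w a, c v w a = c w v a
  neg : ∀ v w a, c v w (-a) = c v w a
  add : ∀ v w a, ∀ t ∈ B v, c v w (a + t) = c v w a
  zero_or : ∀ v w a, c v w a = 0 ∨ 8 ≤ c v w a
  self : ∀ v a, c v v a = 0 ↔ a ∈ B v

/-- Configurations: widths of all translates of the generators, positions of the generators,
and a function on the lattice. -/
abbrev Configuration (V : Type*) (n : ℕ) : Type _ :=
  (V → (Fin n → ℤ) → ℤ) × (V → ℤ) × ((Fin n → ℤ) → ℤ)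

namespace Configuration

variable {V : Type u} {n : ℕ}

/-- Quasi-quadratic configurations which are periodic under `B`. -/
def invariantSubmodule (N : ℕ) (B : V → AddSubgroup (Fin n → ℤ)) :
    Submodule ℤ (Configuration V n) where
  carrier := {f | (∀ w, f.1 w ∈ quasiQuadratic n N ∧
    ∀ t ∈ B w, ∀ a, f.1 w (a + t) = f.1 w a) ∧ f.2.2 ∈ quasiQuadratic n N}
  zero_mem' := ⟨fun _ => ⟨zero_mem _, fun _ _ _ => rfl⟩, zero_mem _⟩
  add_mem' := fun hf hg => ⟨fun w => ⟨add_mem (hf.1 w).1 (hg.1 w).1, fun t ht a =>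
    congrArg₂ (· + ·) ((hf.1 w).2 t ht a) ((hg.1 w).2 t ht a)⟩, add_mem hf.2 hg.2⟩
  smul_mem' := fun k _ hf => ⟨fun w => ⟨Submodule.smul_mem _ k (hf.1 w).1, fun t ht a =>
    congrArg (k * ·) ((hf.1 w).2 t ht a)⟩, Submodule.smul_mem _ k hf.2⟩

/-- It lies in a finitely generated module over the Noetherian ring `ℤ`. -/
theorem invariantSubmodule_fg [Finite V] {N : ℕ} [NeZero N] (B : V → AddSubgroup (Fin n → ℤ)) :
    (invariantSubmodule N B).FG := by
  have hle : invariantSubmodule N B ≤ (Submodule.pi Set.univ fun _ => quasiQuadratic n N).prod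
      ((⊤ : Submodule ℤ (V → ℤ)).prod (quasiQuadratic n N)) :=
    fun f hf => ⟨fun w _ => (hf.1 w).1, trivial, hf.2⟩
  exact Submodule.FG.of_le ((Submodule.fg_pi fun _ => quasiQuadratic_fg).prod
    (Module.Finite.fg_top.prod quasiQuadratic_fg)) hle

/-- Translation of configurations. -/
def shift (b : Fin n → ℤ) : Configuration V n →ₗ[ℤ] Configuration V n where
  toFun f := (fun w a => f.1 w (a - b), f.2.1, fun a => f.2.2 (a - b))
  map_add' _ _ := rfl
  map_smul' _ _ := rfl

/-- Playing the generator `v` for `k` times. -/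
def play [DecidableEq V] (c : V → V → (Fin n → ℤ) → ℤ) (v : V) (k : ℤ) :
    Configuration V n →ₗ[ℤ] Configuration V n where
  toFun f := (fun w a => f.1 w a + c w v a * (k * f.2.1 v + 2 * k ^ 2 * f.1 v 0),
    fun w => f.2.1 w + if w = v then 4 * k * f.1 v 0 else 0, f.2.2)
  map_add' f g := by
    refine Prod.ext (funext fun w => funext fun a => ?_) (Prod.ext (funext fun w => ?_) rfl)
    · simp only [Prod.fst_add, Prod.snd_add, Pi.add_apply]; ring
    · simp only [Prod.fst_add, Prod.snd_add, Pi.add_apply]; split_ifs <;> ring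
  map_smul' r f := by
    refine Prod.ext (funext fun w => funext fun a => ?_) (Prod.ext (funext fun w => ?_) rfl)
    · simp only [Prod.smul_fst, Prod.smul_snd, Pi.smul_apply, smul_eq_mul, RingHom.id_apply]; ring
    · simp only [Prod.smul_fst, Prod.smul_snd, Pi.smul_apply, smul_eq_mul, RingHom.id_apply]
      split_ifs <;> ring

variable {N : ℕ} {B : V → AddSubgroup (Fin n → ℤ)} {c : V → V → (Fin n → ℤ) → ℤ}

theorem shift_mem (b : Fin n → ℤ) :
    ∀ f ∈ invariantSubmodule N B, shift b f ∈ invariantSubmodule N B := by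
  refine fun f hf => ⟨fun w => ⟨?_, fun t ht a => ?_⟩, ?_⟩
  · simpa [shift, sub_eq_add_neg] using translate_mem_quasiQuadratic _ (hf.1 w).1 (-b)
  · exact (congrArg (f.1 w) (by abel)).trans ((hf.1 w).2 t ht (a - b))
  · simpa [shift, sub_eq_add_neg] using translate_mem_quasiQuadratic _ hf.2 (-b)

theorem play_mem [DecidableEq V] (hc : IsInteraction N B c) (v : V) (k : ℤ) :
    ∀ f ∈ invariantSubmodule N B, play c v k f ∈ invariantSubmodule N B := by
  refine fun f hf => ⟨fun w => ⟨add_mem (hf.1 w).1 ?_, fun t ht a => ?_⟩, hf.2⟩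
  · have := Submodule.smul_mem _ (k * f.2.1 v + 2 * k ^ 2 * f.1 v 0) (hc.mem w v)
    convert this using 1
    ext a; simp [mul_comm]
  · simp only [play, LinearMap.coe_mk, AddHom.coe_mk]
    rw [(hf.1 w).2 t ht a, hc.add w v a t ht]

/-- The translations as linear automorphisms of the invariant submodule. -/
def shiftHom (N : ℕ) (B : V → AddSubgroup (Fin n → ℤ)) :
    Multiplicative (Fin n → ℤ) →* (Module.End ℤ (invariantSubmodule N B))ˣ :=
  MonoidHom.toHomUnits
    { toFun := fun b => (shift b.toAdd).restrict (shift_mem _)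
      map_one' := by
        ext f : 2
        simp [shift, LinearMap.restrict_apply]
      map_mul' := fun b b' => by
        ext f : 2
        simp [shift, LinearMap.restrict_apply, sub_sub] }

/-- The plays of one generator as linear automorphisms of the invariant submodule. -/
def playHom [DecidableEq V] (hc : IsInteraction N B c) (v : V) :
    Multiplicative ℤ →* (Module.End ℤ (invariantSubmodule N B))ˣ :=
  MonoidHom.toHomUnits
    { toFun := fun k => (play c v k.toAdd).restrict (play_mem hc _ _)
      map_one' := by
        ext f : 2
        simp [play, LinearMap.restrict_apply]
      map_mul' := fun k l => by
        -- The own width `s` is therefore constant and the position `u` moves by `4ks`; the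
        -- increments `ku + 2k²s` then add up, since `l(u + 4ks) + 2l²s` completes the square.
        have h0 : c v v 0 = 0 := (hc.self v 0).2 (zero_mem _)
        ext f : 2
        refine Prod.ext (funext fun w => funext fun a => ?_) (Prod.ext (funext fun w => ?_) rfl)
        · simp [play, LinearMap.restrict_apply, h0]; ring
        · simp [play, LinearMap.restrict_apply, h0]; split_ifs <;> ring }

theorem shiftHom_apply (b : Fin n → ℤ) (f : invariantSubmodule N B) :
    (((shiftHom N B (.ofAdd b)).1 f).1 : Configuration V n) = shift b f.1 := rfl

/-- Both the width of `v` and its interactions are periodic under `B v`, so a shift by `t` changes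
nothing that the play reads. -/
theorem commute_shiftHom_playHom [DecidableEq V] (hc : IsInteraction N B c) (v : V)
    {t : Fin n → ℤ} (ht : t ∈ B v) (k : Multiplicative ℤ) :
    Commute (shiftHom N B (.ofAdd t)) (playHom hc v k) := by
  have h0 : ∀ f : invariantSubmodule N B, f.1.1 v (-t) = f.1.1 v 0 := fun f => by
    simpa using ((f.2.1 v).2 t ht (-t)).symm
  have h1 : ∀ w a, c w v (a - t) = c w v a := fun w a => by
    rw [hc.symm, hc.symm w, ← hc.add v w (a - t) t ht, sub_add_cancel]
  refine Units.ext (LinearMap.ext fun f => Subtype.ext ?_)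
  change shift t (play c v k.toAdd f.1) = play c v k.toAdd (shift t f.1)
  refine Prod.ext (funext fun w => funext fun a => ?_) (Prod.ext (funext fun w => ?_) rfl)
  · simp [shift, play, h0, h1]
  · simp [shift, play, h0]

/-- Neither play changes the width at `0` or the position that the other one reads. -/
theorem commute_playHom_playHom [DecidableEq V] (hc : IsInteraction N B c) {v w : V} (h : v ≠ w)
    (h0 : c v w 0 = 0) (k l : Multiplicative ℤ) :
    Commute (playHom hc v k) (playHom hc w l) := by
  have h1 : c w v 0 = 0 := by rw [hc.symm, h0]
  refine Units.ext (LinearMap.ext fun f => Subtype.ext ?_)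
  change play c v k.toAdd (play c w l.toAdd f.1) = play c w l.toAdd (play c v k.toAdd f.1)
  refine Prod.ext (funext fun z => funext fun a => ?_) (Prod.ext (funext fun z => ?_) rfl)
  · simp [play, h0, h1, h, h.symm]; ring
  · simp [play, h0, h1, h, h.symm]; ring

end Configuration

theorem isZLinear_of_injective {G M : Type*} [Group G] [AddCommGroup M] [Module.Finite ℤ M]
    [Module.Free ℤ M] (f : G →* (Module.End ℤ M)ˣ) (hf : Function.Injective f) : IsZLinear G := by
  let b := Module.finBasis ℤ M
  refine ⟨_, (Units.map (LinearMap.toMatrixAlgEquiv b).toRingEquiv.toMonoidHom).comp f, ?_⟩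
  rw [MonoidHom.coe_comp]
  exact (Units.map_injective (LinearMap.toMatrixAlgEquiv b).injective).comp hf

open Configuration in
/-- A group generated by a lattice and by finitely many elements is `ℤ`-linear, if translates of the
generators which do not interact commute, and if it is universal with this property. -/
theorem isZLinear_of_interaction {G : Type*} [Group G] {V : Type u} [Finite V] {n N : ℕ} [NeZero N]
    {B : V → AddSubgroup (Fin n → ℤ)} {c : V → V → (Fin n → ℤ) → ℤ} (hc : IsInteraction N B c)
    (i : Multiplicative (Fin n → ℤ) →* G) (x : V → G)
    (hfix : ∀ v, ∀ t ∈ B v, Commute (i (.ofAdd t)) (x v))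
    (hcomm : ∀ v w a, v ≠ w → c v w a = 0 →
      Commute (x v) (i (.ofAdd a) * x w * (i (.ofAdd a))⁻¹))
    (hgen : Subgroup.closure (Set.range i ∪ Set.range x) = ⊤)
    (huniv : ∀ (H : Type u) [Group H] (i' : Multiplicative (Fin n → ℤ) →* H) (x' : V → H),
      (∀ v, ∀ t ∈ B v, Commute (i' (.ofAdd t)) (x' v)) →
      (∀ v w, v ≠ w → c v w 0 = 0 → Commute (x' v) (x' w)) →
      ∃ f : G →* H, (∀ a, f (i a) = i' a) ∧ ∀ v, f (x v) = x' v) :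
    IsZLinear G := by
  classical
  let P := invariantSubmodule N B
  have : Module.Finite ℤ P := Module.Finite.iff_fg.2 (invariantSubmodule_fg B)
  -- This is the only target to which `huniv` is applied.
  obtain ⟨ρ, hρi, hρx⟩ := huniv (Module.End ℤ P)ˣ (shiftHom N B)
    (fun v => playHom hc v (.ofAdd 1)) (fun v t ht => commute_shiftHom_playHom hc v ht _)
    (fun v w h h0 => commute_playHom_playHom hc h h0 _ _)
  have hρk : ∀ v (k : ℤ), ρ (x v ^ k) = playHom hc v (.ofAdd k) := fun v k => by
    rw [map_zpow, hρx, ← map_zpow, ← ofAdd_zsmul, smul_eq_mul, mul_one]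
  refine isZLinear_of_injective ρ ((injective_iff_map_eq_one ρ).2 fun g hg => ?_)
  let f₀ : P := ⟨(fun _ _ => 1, fun _ => 0, fun _ => 0), fun _ =>
    ⟨const_mem_quasiQuadratic 1, fun _ _ _ => rfl⟩, const_mem_quasiQuadratic 0⟩
  let Ω := Σ v : V, (Fin n → ℤ) ⧸ B v
  let rep : Ω → Fin n → ℤ := fun y => y.2.out
  let X : Ω → G := fun y => i (.ofAdd (rep y)) * x y.1 * (i (.ofAdd (rep y)))⁻¹
  let st : G → Configuration V n := fun g => ((ρ g).1 f₀).1
  let s : Ω → G → ℤ := fun y g => (st g).1 y.1 (rep y)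
  -- All translates of a vertex share one position. This is harmless: distinct translates of the
  -- same vertex are far from each other, and `u_far` allows both alternatives.
  let p : Ω → G → ℤ := fun y g => (st g).2.1 y.1
  have hX : ∀ y (k : ℤ) g, st (X y ^ k * g) =
      shift (rep y) (play c y.1 k (shift (-rep y) (st g))) := by
    intro y k g
    have h1 : X y ^ k = i (.ofAdd (rep y)) * x y.1 ^ k * i (.ofAdd (-rep y)) := by
      simp only [X, conj_zpow, ofAdd_neg, map_inv]
    simp only [st]
    rw [h1, map_mul, map_mul, map_mul, hρk, hρi, hρi]
    rfl
  have hs : ∀ y (k : ℤ) g z, s z (X y ^ k * g) = s z g +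
      c z.1 y.1 (rep z - rep y) * (k * p y g + 2 * k ^ 2 * s y g) := by
    intro y k g z
    simp only [s, p, hX]
    simp [shift, play]
  have hp : ∀ y (k : ℤ) g z, p z (X y ^ k * g) = p z g +
      if z.1 = y.1 then 4 * k * s y g else 0 := by
    intro y k g z
    simp only [s, p, hX]
    simp [shift, play]
  have hself : ∀ v, c v v 0 = 0 := fun v => (hc.self v 0).2 (zero_mem _)
  have hne : ∀ y z : Ω, y ≠ z → c z.1 y.1 (rep z - rep y) = 0 → z.1 ≠ y.1 := by
    rintro ⟨v, a⟩ ⟨w, b⟩ hyz h0 (rfl : w = v)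
    rw [hc.self] at h0
    apply hyz
    congr 1
    rw [← QuotientAddGroup.out_eq' a, ← QuotientAddGroup.out_eq' b, QuotientAddGroup.eq,
      neg_add_eq_sub]
    exact h0
  have hgame : IsNumbersGame X s p fun y z => y ≠ z ∧ c z.1 y.1 (rep z - rep y) ≠ 0 :=
    { s_one := fun y => by simp [s, st, f₀]
      u_one := fun y => by simp [p, st, f₀]
      s_self := fun y k g => by simp [hs, hself]
      u_self := fun y k g => by simp [hp]
      far_irrefl := fun y h => h.1 rfl
      far_symm := fun y z h => ⟨h.1.symm, by
        rw [hc.symm, ← hc.neg, neg_sub]; exact h.2⟩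
      comm := fun y z h h' => by
        have h0 : c z.1 y.1 (rep z - rep y) = 0 := by
          by_contra h0; exact h' ⟨h, h0⟩
        have h1 := hcomm y.1 z.1 (rep z - rep y) (hne y z h h0).symm (by rw [hc.symm, h0])
        rw [← Commute.conj_iff (i (.ofAdd (rep y)))] at h1
        convert h1 using 1
        simp only [X]
        rw [sub_eq_neg_add, ofAdd_add, ofAdd_neg, map_mul, map_inv]
        group
      s_comm := fun y z h h' k g => by
        have h0 : c z.1 y.1 (rep z - rep y) = 0 := by
          by_contra h0; exact h' ⟨h, h0⟩
        rw [hs, h0, zero_mul, add_zero]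
      u_comm := fun y z h h' k g => by
        have h0 : c z.1 y.1 (rep z - rep y) = 0 := by
          by_contra h0; exact h' ⟨h, h0⟩
        rw [hp, if_neg (hne y z h h0), add_zero]
      s_far := fun y z h => ⟨_, (hc.zero_or z.1 y.1 _).resolve_left h.2, fun k g => hs y k g z⟩
      u_far := fun y z h k g => by
        rw [hp]; split_ifs <;> simp }
  -- Changing the representative of a coset of `B v` does not change the conjugate, by `hfix`.
  have hXa : ∀ a v, i a * x v * (i a)⁻¹ ∈ Subgroup.closure (Set.range X) := by
    intro a v
    have h1 : i a * x v * (i a)⁻¹ = X ⟨v, (a.toAdd : (Fin n → ℤ) ⧸ B v)⟩ := by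
      obtain ⟨t, ht⟩ := QuotientAddGroup.mk_out_eq_add (B v) a.toAdd
      have h2 : rep ⟨v, (a.toAdd : (Fin n → ℤ) ⧸ B v)⟩ = a.toAdd + t := ht
      simp only [X, h2, ofAdd_add, map_mul, ofAdd_toAdd]
      rw [mul_assoc (i a) _ (x v), (hfix v t t.2).eq]
      group
    rw [h1]
    exact Subgroup.subset_closure ⟨_, rfl⟩
  have hdec : ∀ g : G, ∃ k ∈ Subgroup.closure (Set.range X), ∃ a, g = k * i a := by
    have hconj : ∀ b, ∀ k ∈ Subgroup.closure (Set.range X),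
        i b * k * (i b)⁻¹ ∈ Subgroup.closure (Set.range X) := by
      intro b
      suffices Subgroup.closure (Set.range X) ≤
          (Subgroup.closure (Set.range X)).comap (MulAut.conj (i b)).toMonoidHom from
        fun k hk => this hk
      rw [Subgroup.closure_le]
      rintro _ ⟨y, rfl⟩
      have := hXa (b * .ofAdd (rep y)) y.1
      simpa [X, mul_assoc] using this
    have hxv : ∀ v, x v ∈ Subgroup.closure (Set.range X) := fun v => by simpa using hXa 1 v
    have hmul : ∀ b g, (∃ k ∈ Subgroup.closure (Set.range X), ∃ a, g = k * i a) →
        ∃ k ∈ Subgroup.closure (Set.range X), ∃ a, i b * g = k * i a := by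
      rintro b _ ⟨k, hk, a, rfl⟩
      exact ⟨_, hconj b k hk, b * a, by rw [map_mul]; group⟩
    intro g
    have hg : g ∈ Subgroup.closure (Set.range i ∪ Set.range x) := hgen ▸ Subgroup.mem_top g
    induction hg using Subgroup.closure_induction_left with
    | one => exact ⟨1, one_mem _, 1, by simp⟩
    | mul_left z hz g _ hg =>
      obtain ⟨b, rfl⟩ | ⟨v, rfl⟩ := hz
      · exact hmul b g hg
      · obtain ⟨k, hk, a, rfl⟩ := hg
        exact ⟨x v * k, mul_mem (hxv v) hk, a, (mul_assoc _ _ _).symm⟩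
    | inv_mul_cancel z hz g _ hg =>
      obtain ⟨b, rfl⟩ | ⟨v, rfl⟩ := hz
      · rw [← map_inv]; exact hmul b⁻¹ g hg
      · obtain ⟨k, hk, a, rfl⟩ := hg
        exact ⟨(x v)⁻¹ * k, mul_mem (inv_mem (hxv v)) hk, a, (mul_assoc _ _ _).symm⟩
  obtain ⟨k, hk, a, rfl⟩ := hdec g
  -- The starting configuration is invariant under shifts, so the lattice factor of `g` does not
  -- affect its state.
  have hst : st k = f₀.1 := by
    have h1 : st (k * i a) = st k := by
      simp only [st]
      rw [map_mul, hρi]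
      rfl
    rw [← h1]
    simp only [st]
    rw [hg]; rfl
  have hk1 : k = 1 := hgame.eq_one_of_abs_lt hk fun y => by simp [s, p, hst, f₀]
  subst hk1
  rw [one_mul, hρi] at hg
  suffices a.toAdd = 0 by
    have : a = 1 := this
    simp [this]
  ext j
  -- The third component exists for this purpose: a shift by `a` lowers the `j`-th coordinate
  -- function by the constant `a j`.
  let f : P := ⟨(fun _ _ => 0, fun _ => 0, fun a => a j), fun _ =>
    ⟨const_mem_quasiQuadratic 0, fun _ _ _ => rfl⟩,
    affine_mem_quasiQuadratic (coord_mem_affineFunctions j)⟩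
  have h1 : shift a.toAdd f.1 = f.1 := by
    rw [← shiftHom_apply (N := N) (B := B), ofAdd_toAdd, hg]; rfl
  have h2 := congrFun (congrArg (fun f : Configuration V n => f.2.2) h1) 0
  simpa [shift, f] using h2

/-! ### Lattices amalgamated with right-angled Artin groups -/

/-- A translate of `w` by `a` commutes with an adjacent `v` when `a` fixes `v` or `w`. By `hb` the
multiples of `b v` and of `b w` together are the multiples of one vector, so a single function has
the required zeros. -/
theorem exists_interaction {V : Type*} [Finite V] (Γ : SimpleGraph V) {n : ℕ}
    (b : V → Fin n → ℤ) (hb : ∀ v w, Γ.Adj v w → b v = b w ∨ b v = 0 ∨ b w = 0) :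
    ∃ (N : ℕ) (c : V → V → (Fin n → ℤ) → ℤ), N ≠ 0 ∧
      IsInteraction N (fun v => AddSubgroup.zmultiples (b v)) c ∧
      ∀ v w a, v ≠ w → (c v w a = 0 ↔ Γ.Adj v w ∧
        (a ∈ AddSubgroup.zmultiples (b v) ∨ a ∈ AddSubgroup.zmultiples (b w))) := by
  classical
  have := Fintype.ofFinite V
  choose d hd hD using exists_quasiQuadratic_zero_iff (n := n)
  let N := ∏ v, d (b v)
  have hdN : ∀ v, d (b v) ∣ N := fun v =>
    Finset.dvd_prod_of_mem (fun v => d (b v)) (Finset.mem_univ v)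
  choose D hD using fun a => hD a N
  -- The function depends only on the vector, so equal vectors give equal functions and `c` is
  -- symmetric. The default `0` is never reached at a `b v`.
  let D' : (Fin n → ℤ) → (Fin n → ℤ) → ℤ := fun a => if h : d a ∣ N then D a h else 0
  have hD' : ∀ v, D' (b v) ∈ quasiQuadratic n N ∧ (∀ x, 0 ≤ D' (b v) x) ∧
      (∀ x, D' (b v) (-x) = D' (b v) x) ∧ (∀ x, D' (b v) (x + b v) = D' (b v) x) ∧
      ∀ x, D' (b v) x = 0 ↔ x ∈ AddSubgroup.zmultiples (b v) := fun v => by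
    simp only [D', dif_pos (hdN v)]
    exact hD _ _
  -- This selects the endpoint whose vector generates both subgroups, avoiding a zero vector when
  -- possible.
  let p : V → V → V := fun v w => if b v = 0 then w else v
  have hp : ∀ v w, v = w ∨ Γ.Adj v w → b (p v w) = b (p w v) ∧
      (b v = b (p v w) ∨ b v = 0) ∧ (b w = b (p v w) ∨ b w = 0) := by
    rintro v w (rfl | h)
    · simp [p]
    · have := hb v w h
      simp only [p]
      split_ifs <;> simp_all
  refine ⟨N, fun v w a => if v = w ∨ Γ.Adj v w then 8 * D' (b (p v w)) a else 8,
    Finset.prod_ne_zero_iff.2 fun v _ => hd _, ⟨fun v w => ?_, fun v w a => ?_, fun v w a => ?_,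
      fun v w a t ht => ?_, fun v w a => ?_, fun v a => ?_⟩, fun v w a hvw => ?_⟩
  · by_cases h : v = w ∨ Γ.Adj v w
    · simp only [if_pos h]
      exact Submodule.smul_mem _ 8 (hD' _).1
    · simp only [if_neg h]
      exact const_mem_quasiQuadratic 8
  · by_cases h : v = w ∨ Γ.Adj v w
    · rw [if_pos h, if_pos (h.imp Eq.symm SimpleGraph.Adj.symm), (hp v w h).1]
    · rw [if_neg h, if_neg fun h' => h (h'.imp Eq.symm SimpleGraph.Adj.symm)]
  · simp only [(hD' _).2.2.1]
  · by_cases h : v = w ∨ Γ.Adj v w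
    · simp only [if_pos h]
      congr 1
      obtain h0 | h0 := (hp v w h).2.1
      · have hper : Function.Periodic (D' (b (p v w))) (b v) := h0 ▸ (hD' (p v w)).2.2.2.1
        obtain ⟨z, rfl⟩ := ht
        exact hper.zsmul z a
      · rw [h0, AddSubgroup.zmultiples_zero_eq_bot, AddSubgroup.mem_bot] at ht
        rw [ht, add_zero]
    · simp only [if_neg h]
  · have := (hD' (p v w)).2.1 a
    split_ifs <;> omega
  · have : p v v = v := by simp [p]
    simp [this, (hD' v).2.2.2.2]
  · by_cases h : Γ.Adj v w
    · obtain ⟨-, h1, h2⟩ := hp v w (Or.inr h)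
      simp only [h, or_true, if_true, true_and, mul_eq_zero, OfNat.ofNat_ne_zero, false_or,
        (hD' _).2.2.2.2]
      constructor
      · intro ha
        by_cases h0 : b v = 0
        · right; simpa [p, h0] using ha
        · left; simpa [p, h0] using ha
      · rintro (ha | ha)
        · obtain h1 | h1 := h1
          · rwa [← h1]
          · rw [h1, AddSubgroup.zmultiples_zero_eq_bot, AddSubgroup.mem_bot] at ha
            exact ha ▸ zero_mem _
        · obtain h2 | h2 := h2
          · rwa [← h2]
          · rw [h2, AddSubgroup.zmultiples_zero_eq_bot, AddSubgroup.mem_bot] at ha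
            exact ha ▸ zero_mem _
    · simp [h, hvw]

/-- A group generated by a lattice and by the vertices of a finite graph is `ℤ`-linear, if it is
presented by commutation relations between adjacent vertices and relations saying that each vertex
`v` commutes with an element `b v` of the lattice. -/
theorem isZLinear_of_graph {G : Type*} [Group G] {V : Type u} [Finite V] (Γ : SimpleGraph V) {n : ℕ}
    (b : V → Fin n → ℤ) (hb : ∀ v w, Γ.Adj v w → b v = b w ∨ b v = 0 ∨ b w = 0)
    (i : Multiplicative (Fin n → ℤ) →* G) (x : V → G)
    (hfix : ∀ v, Commute (i (.ofAdd (b v))) (x v))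
    (hcomm : ∀ v w, Γ.Adj v w → Commute (x v) (x w))
    (hgen : Subgroup.closure (Set.range i ∪ Set.range x) = ⊤)
    (huniv : ∀ (H : Type u) [Group H] (i' : Multiplicative (Fin n → ℤ) →* H) (x' : V → H),
      (∀ v, Commute (i' (.ofAdd (b v))) (x' v)) →
      (∀ v w, Γ.Adj v w → Commute (x' v) (x' w)) →
      ∃ f : G →* H, (∀ a, f (i a) = i' a) ∧ ∀ v, f (x v) = x' v) :
    IsZLinear G := by
  obtain ⟨N, c, hN, hc, hc0⟩ := exists_interaction Γ b hb
  have : NeZero N := ⟨hN⟩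
  have hfix' : ∀ v, ∀ t ∈ AddSubgroup.zmultiples (b v), Commute (i (.ofAdd t)) (x v) := by
    rintro v t ⟨z, rfl⟩
    change Commute (i (.ofAdd (z • b v))) (x v)
    rw [ofAdd_zsmul, map_zpow]
    exact (hfix v).zpow_left z
  refine isZLinear_of_interaction hc i x hfix' (fun v w a hvw h0 => ?_) hgen
    fun H _ i' x' h1 h2 => huniv H i' x' (fun v => h1 v _ (AddSubgroup.mem_zmultiples _))
      fun v w h => h2 v w h.ne ((hc0 v w 0 h.ne).2 ⟨h, Or.inl (zero_mem _)⟩)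
  obtain ⟨hadj, ha | ha⟩ := (hc0 v w a hvw).1 h0
  -- Here `a` commutes with `x v`; in the other case it commutes with `x w` and the conjugation
  -- disappears.
  · have h1 := hfix' v a ha
    exact (h1.symm.mul_right (hcomm v w hadj)).mul_right h1.symm.inv_right
  · rw [(hfix' w a ha).eq, mul_inv_cancel_right]
    exact hcomm v w hadj

namespace RAAG

variable {V : Type*} {Γ : SimpleGraph V}

theorem commute_of {u v : V} (h : Γ.Adj u v) :
    Commute (PresentedGroup.of u : RAAG Γ) (PresentedGroup.of v) := by
  have := PresentedGroup.one_of_mem (rels := {r : FreeGroup V | ∃ u v, Γ.Adj u v ∧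
    r = FreeGroup.of u * FreeGroup.of v * (FreeGroup.of u)⁻¹ * (FreeGroup.of v)⁻¹}) ⟨u, v, h, rfl⟩
  simp only [map_mul, map_inv] at this
  rw [mul_inv_eq_one, mul_inv_eq_iff_eq_mul] at this
  exact this

theorem exists_lift {H : Type*} [Group H] (f : V → H)
    (hf : ∀ u v, Γ.Adj u v → Commute (f u) (f v)) :
    ∃ F : RAAG Γ →* H, ∀ v, F (PresentedGroup.of v) = f v := by
  refine ⟨PresentedGroup.toGroup (f := f) ?_, fun v => PresentedGroup.toGroup.of _⟩
  rintro _ ⟨u, v, h, rfl⟩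
  simp [(hf u v h).eq]

end RAAG

/-- The generator `t l` equals the lattice element `a l` and can be dropped. Its commutation with a
neighbour becomes the condition that the neighbour commutes with `a l`. -/
theorem isZLinear_of_amalgam {m : ℕ} {C : Type*} [Group C] (hC : IsFreeAbelianOfFiniteRank C)
    {L : Fin m → Type u} [∀ l, Group (L l)] (S : ∀ l, Set (L l))
    (hS : ∀ l, IsRAAGGeneratingSet (S l)) (t : ∀ l, S l) (a : Fin m → C)
    {G : Type*} [Group G] (j₀ : C →* G) (j : ∀ l, L l →* G) (hj : ∀ l, j₀ (a l) = j l (t l))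
    (hgen : Subgroup.closure (Set.range j₀ ∪ ⋃ l, Set.range (j l)) = ⊤)
    (huniv : ∀ (H : Type u) [Group H] (f₀ : C →* H) (f : ∀ l, L l →* H),
      (∀ l, f₀ (a l) = f l (t l)) →
      ∃ F : G →* H, (∀ c, F (j₀ c) = f₀ c) ∧ ∀ l g, F (j l g) = f l g) :
    IsZLinear G := by
  classical
  obtain ⟨n, ⟨e⟩⟩ := hC
  choose hfin Γ φ hφ using hS
  have hcommS : ∀ l (s s' : S l), (Γ l).Adj s s' → Commute (s : L l) s' := fun l s s' h => by
    rw [← hφ, ← hφ]; exact (RAAG.commute_of h).map (φ l)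
  have hlift : ∀ (H : Type u) [Group H] l (f : S l → H),
      (∀ s s', (Γ l).Adj s s' → Commute (f s) (f s')) →
      ∃ F : L l →* H, ∀ s : S l, F s = f s := fun H _ l f hf => by
    obtain ⟨F, hF⟩ := RAAG.exists_lift f hf
    exact ⟨F.comp (φ l).symm.toMonoidHom, fun s => by simp [← hφ, hF]⟩
  have hclosure : ∀ l, Subgroup.closure (S l) = ⊤ := fun l => by
    have h1 := congrArg (Subgroup.map (φ l).toMonoidHom) (PresentedGroup.closure_range_of
      {r : FreeGroup (S l) | ∃ u v, (Γ l).Adj u v ∧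
        r = FreeGroup.of u * FreeGroup.of v * (FreeGroup.of u)⁻¹ * (FreeGroup.of v)⁻¹})
    rw [MonoidHom.map_closure, Subgroup.map_top_of_surjective _ (φ l).surjective,
      ← Set.range_comp] at h1
    rw [← h1]
    congr 1
    ext s
    constructor
    · exact fun hs => ⟨⟨s, hs⟩, hφ l ⟨s, hs⟩⟩
    · rintro ⟨s, rfl⟩
      have h2 : (φ l).toMonoidHom (PresentedGroup.of s) = s := hφ l s
      rw [Function.comp_apply, h2]
      exact s.2
  let V := Σ l, {s : S l // s ≠ t l}
  have : ∀ l, Finite (S l) := hfin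
  let Λ : SimpleGraph V :=
    { Adj := fun v w => ∃ (l : Fin m) (s s' : {s : S l // s ≠ t l}),
        (Γ l).Adj s.1 s'.1 ∧ v = ⟨l, s⟩ ∧ w = ⟨l, s'⟩
      symm := ⟨fun v w ⟨l, s, s', h, hv, hw⟩ => ⟨l, s', s, h.symm, hw, hv⟩⟩
      loopless := ⟨fun v ⟨l, s, s', h, hv, hw⟩ => by
        obtain rfl : s = s' := eq_of_heq (Sigma.mk.inj (hv.symm.trans hw)).2
        exact h.ne rfl⟩ }
  let b : V → Fin n → ℤ := fun v => if (Γ v.1).Adj v.2.1 (t v.1) then (e (a v.1)).toAdd else 0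
  refine isZLinear_of_graph Λ b ?_ (j₀.comp e.symm.toMonoidHom) (fun v => j v.1 v.2.1) ?_ ?_ ?_ ?_
  -- Edges stay within one factor `l`, where the vectors are `a l` or zero.
  · rintro _ _ ⟨l, s, s', h, rfl, rfl⟩
    simp only [b]
    split_ifs <;> simp
  · rintro ⟨l, s⟩
    simp only [b]
    split_ifs with h
    · have := ((hcommS l _ _ h).map (j l)).symm
      rw [← hj] at this
      simpa using this
    · simp
  · rintro _ _ ⟨l, s, s', h, rfl, rfl⟩
    exact (hcommS l _ _ h).map (j l)
  · rw [eq_top_iff, ← hgen, Subgroup.closure_le]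
    have h0 : ∀ c, j₀ c ∈ Subgroup.closure (Set.range (j₀.comp e.symm.toMonoidHom) ∪
        Set.range fun v : V => j v.1 v.2.1) := fun c =>
      Subgroup.subset_closure (Or.inl ⟨e c, by simp⟩)
    rintro g (⟨c, rfl⟩ | hg)
    · exact h0 c
    · obtain ⟨l, hg⟩ := Set.mem_iUnion.1 hg
      suffices ⊤ ≤ (Subgroup.closure (Set.range (j₀.comp e.symm.toMonoidHom) ∪
          Set.range fun v : V => j v.1 v.2.1)).comap (j l) by
        obtain ⟨g, rfl⟩ := hg
        exact this (Subgroup.mem_top g)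
      rw [← hclosure l, Subgroup.closure_le]
      intro s hs
      by_cases h : (⟨s, hs⟩ : S l) = t l
      · have h1 : j l s = j₀ (a l) := by rw [hj, ← h]
        simp only [SetLike.mem_coe, Subgroup.mem_comap]
        rw [h1]; exact h0 _
      · exact Subgroup.subset_closure (Or.inr ⟨⟨l, ⟨s, hs⟩, h⟩, rfl⟩)
  · intro H _ i' x' h1 h2
    -- The eliminated generator `t l` is sent to the image of `a l`.
    have hf : ∀ l, ∃ F : L l →* H, ∀ s : S l, F s =
        if h : s = t l then i' (e (a l)) else x' ⟨l, s, h⟩ := by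
      intro l
      have key : ∀ s (h : s ≠ t l), (Γ l).Adj s (t l) → Commute (i' (e (a l))) (x' ⟨l, s, h⟩) := by
        intro s h hadj
        have := h1 ⟨l, s, h⟩
        simp only [b] at this
        rwa [if_pos hadj] at this
      refine hlift H l _ fun s s' h => ?_
      by_cases hs : s = t l <;> by_cases hs' : s' = t l
      · exact absurd (hs.trans hs'.symm) h.ne
      · rw [dif_pos hs, dif_neg hs']
        exact key s' hs' (hs ▸ h.symm)
      · rw [dif_neg hs, dif_pos hs']
        exact (key s hs (hs' ▸ h)).symm
      · rw [dif_neg hs, dif_neg hs']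
        exact h2 _ _ ⟨l, ⟨s, hs⟩, ⟨s', hs'⟩, h, rfl, rfl⟩
    choose f hf using hf
    obtain ⟨F, hF₀, hF⟩ := huniv H (i'.comp e.toMonoidHom) f fun l => by simp [hf]
    refine ⟨F, fun c => by simp [hF₀], fun ⟨l, s, hs⟩ => ?_⟩
    rw [hF, hf, dif_neg hs]

/-! ### Vertex groups in the fundamental group, and its universal property. -/

namespace GraphOfGroups

variable {V E : Type*} {Γ : OrientedGraph V E} (𝒢 : GraphOfGroups Γ) (T : Set E)

/-- The canonical homomorphism of a vertex group to the fundamental group. -/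
def vertexHom (v : V) : 𝒢.vertexGroup v →* 𝒢.FundamentalGroup T :=
  (QuotientGroup.mk' _).comp ((QuotientGroup.mk' _).comp (𝒢.ofVertex v))

variable {T}

theorem mk_stableLetter {e : E} (he : e ∈ T) :
    (QuotientGroup.mk (𝒢.stableLetter e) : 𝒢.FundamentalGroup T) = 1 :=
  (QuotientGroup.eq_one_iff _).2 (Subgroup.subset_normalClosure ⟨e, he, rfl⟩)

theorem vertexHom_α_eq_vertexHom_ω {e : E} (he : e ∈ T) (g : 𝒢.edgeGroup e) :
    𝒢.vertexHom T _ (𝒢.α e g) = 𝒢.vertexHom T _ (𝒢.ω e g) := by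
  have h1 : (QuotientGroup.mk' (Subgroup.normalClosure 𝒢.pathRelators))
      (𝒢.letter e * 𝒢.ofVertex _ (𝒢.α e g) * (𝒢.letter e)⁻¹ * (𝒢.ofVertex _ (𝒢.ω e g))⁻¹) = 1 :=
    (QuotientGroup.eq_one_iff _).2 (Subgroup.subset_normalClosure ⟨e, g, rfl⟩)
  have h2 := congrArg (QuotientGroup.mk' (Subgroup.normalClosure (𝒢.stableLetter '' T))) h1
  simp only [map_mul, map_inv, map_one] at h2
  have h3 : (QuotientGroup.mk' (Subgroup.normalClosure (𝒢.stableLetter '' T)))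
      ((QuotientGroup.mk' (Subgroup.normalClosure 𝒢.pathRelators)) (𝒢.letter e)) = 1 :=
    𝒢.mk_stableLetter he
  rw [h3, one_mul, inv_one, mul_one, mul_inv_eq_one] at h2
  exact h2

/-- When all edges lie in the subtree, every stable letter dies and only the vertex groups remain.
-/
theorem closure_range_vertexHom (hT : T = Set.univ) :
    Subgroup.closure (⋃ v, Set.range (𝒢.vertexHom T v)) = ⊤ := by
  let K := Subgroup.closure (⋃ v, Set.range (𝒢.vertexHom T v))
  let π : 𝒢.BigFreeProduct →* 𝒢.FundamentalGroup T :=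
    (QuotientGroup.mk' _).comp (QuotientGroup.mk' _)
  have hπ : Function.Surjective π :=
    (QuotientGroup.mk'_surjective _).comp (QuotientGroup.mk'_surjective _)
  have h1 : ∀ y, π (Monoid.Coprod.inl y) ∈ K := by
    intro y
    induction y using Monoid.CoprodI.induction_on with
    | one => simp [one_mem]
    | of v g => exact Subgroup.subset_closure (Set.mem_iUnion.2 ⟨v, g, rfl⟩)
    | mul y z hy hz => rw [map_mul, map_mul]; exact mul_mem hy hz
  have h2 : ∀ y, π (Monoid.Coprod.inr y) = 1 := by
    have : π.comp Monoid.Coprod.inr = 1 := by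
      ext e
      exact 𝒢.mk_stableLetter (hT ▸ Set.mem_univ e)
    exact fun y => DFunLike.congr_fun this y
  refine (Subgroup.eq_top_iff' K).2 fun g => ?_
  obtain ⟨y, rfl⟩ := hπ g
  induction y using Monoid.Coprod.induction_on with
  | inl y => exact h1 y
  | inr y => rw [h2]; exact one_mem _
  | mul y z hy hz => rw [map_mul]; exact mul_mem hy hz

theorem exists_lift {H : Type*} [Group H] (f : ∀ v, 𝒢.vertexGroup v →* H)
    (hf : ∀ e g, f _ (𝒢.α e g) = f _ (𝒢.ω e g)) :
    ∃ F : 𝒢.FundamentalGroup T →* H, ∀ v g, F (𝒢.vertexHom T v g) = f v g := by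
  let F₁ : 𝒢.BigFreeProduct →* H := Monoid.Coprod.lift (Monoid.CoprodI.lift f) 1
  have hv : ∀ v g, F₁ (𝒢.ofVertex v g) = f v g := fun v g => by simp [F₁, ofVertex]
  have hl : ∀ e, F₁ (𝒢.letter e) = 1 := fun e => by simp [F₁, letter]
  let F₂ : 𝒢.PathGroup →* H := QuotientGroup.lift _ F₁ (by
    refine Subgroup.normalClosure_le_normal (N := F₁.ker) ?_
    rintro _ ⟨e, g, rfl⟩
    simp [MonoidHom.mem_ker, hv, hl, hf])
  refine ⟨QuotientGroup.lift _ F₂ (by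
    refine Subgroup.normalClosure_le_normal (N := F₂.ker) ?_
    rintro _ ⟨e, -, rfl⟩
    exact hl e), fun v g => hv v g⟩

end GraphOfGroups

/-- The first edge of a path from a leaf to the centre must be the only edge at that leaf. -/
theorem starGraph_maximalSubtree_eq_univ {m : ℕ} {T : Set (Fin m)}
    (hT : (starGraph m).IsMaximalSubtree T) : T = Set.univ := by
  refine Set.eq_univ_of_forall fun i => ?_
  have h1 := hT.2.2.connected.preconnected
  obtain ⟨p⟩ := h1 (some i) none
  cases p with
  | cons h p =>
    obtain ⟨⟨e, he, h⟩, -⟩ := (SimpleGraph.fromEdgeSet_adj _).1 h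
    have h2 : e = i := by simpa [starGraph] using (Sym2.eq_iff.1 h).imp (fun h => h.1) (fun h => h.2)
    exact h2 ▸ he

theorem mainTheorem10 (m : ℕ) (𝒢 : GraphOfGroups (starGraph m))
    (h_center : IsFreeAbelianOfFiniteRank (𝒢.vertexGroup none))
    (S : ∀ i : Fin m, Set (𝒢.vertexGroup (some i)))
    (h_leaf : ∀ i, IsRAAGGeneratingSet (S i))
    (k : ∀ i : Fin m, 𝒢.edgeGroup i)
    (h_cyclic : ∀ (i : Fin m) (g : 𝒢.edgeGroup i), g ∈ Subgroup.zpowers (k i))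
    (h_gen : ∀ i : Fin m, 𝒢.ω i (k i) ∈ S i ∨
      ∃ S' : Set (𝒢.vertexGroup (some i)), IsRAAGGeneratingSet S' ∧ 𝒢.ω i (k i) ∈ S')
    (T : Set (Fin m)) (hT : (starGraph m).IsMaximalSubtree T) :
    IsZLinear (𝒢.FundamentalGroup T) := by
  have hTu := starGraph_maximalSubtree_eq_univ hT
  have hS : ∀ i, ∃ S' : Set (𝒢.vertexGroup (some i)), IsRAAGGeneratingSet S' ∧ 𝒢.ω i (k i) ∈ S' :=
    fun i => (h_gen i).elim (fun h => ⟨S i, h_leaf i, h⟩) id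
  choose S' hS' hkS' using hS
  refine isZLinear_of_amalgam h_center S' hS' (fun i => ⟨𝒢.ω i (k i), hkS' i⟩)
    (fun i => 𝒢.α i (k i)) (𝒢.vertexHom T none) (fun i => 𝒢.vertexHom T (some i))
    (fun i => 𝒢.vertexHom_α_eq_vertexHom_ω (hTu ▸ Set.mem_univ i) (k i)) ?_ ?_
  · rw [← 𝒢.closure_range_vertexHom hTu]
    congr 1
    ext g
    simp only [Set.mem_union, Set.mem_iUnion, Option.exists]
  · intro H _ f₀ f hf
    let f' : ∀ v, 𝒢.vertexGroup v →* H := fun v => match v with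
      | none => f₀
      | some i => f i
    obtain ⟨F, hF⟩ := 𝒢.exists_lift (T := T) f' (by
      intro i g
      -- Agreement on the generator `k i` gives agreement on the cyclic edge group.
      obtain ⟨z, rfl⟩ := h_cyclic i g
      have h1 : f' _ (𝒢.α i (k i)) = f' _ (𝒢.ω i (k i)) := hf i
      simp only [map_zpow, h1])
    exact ⟨F, fun c => hF none c, fun i g => hF (some i) g⟩
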